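/- Let $F$ be an algebraically closed field of characteristic $2$, and let $n\ge 3$ be even, but not a power of $2$. Let $M$ be the natural permutation $F\mathfrak{S}_n$-module with permutation basis $\gamma_1,\dots,\gamma_n$, and put $$M'=\Big\{\sum_i a_i\gamma_i : a_i\in F,\ \sum_i a_i=0\Big\},\qquad M''=\Big\{a\sum_i\gamma_i : a\in F\Big\}\subseteq M'.$$ Let $D=D^{(n-1,1)}:=M'/M''$ be the natural simple $F\mathfrak{S}_n$-module, and let $P_n$ be a Sylow $2$-subgroup of $\mathfrak{S}_n$. Then $D$ has vertex $P_n$ and source $\operatorname{Res}^{\mathfrak{S}_n}_{P_n}(D)$. Here a vertex of an indecomposable finitely generated $FG$-module $V$ ($G$ a finite group) is a subgroup $Q\le G$ that is minimal such that $V$ is relatively $Q$-projective, i.e. isomorphic to a direct summand of $\operatorname{Ind}_Q^G(W)$ for some finitely generated $FQ$-module $W$; and a source of $V$ (with respect to the vertex $Q$) is an indecomposable finitely generated $FQ$-module $S$ such that $V$ is isomorphic to a direct summand of $\operatorname{Ind}_Q^G(S)$. -/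

import Mathlib

open Equiv (Perm)
open scoped MonoidAlgebra

universe u v w

/-! Vertices and sources of finite-dimensional modules over a finite group `G`.  An `FG`-module is
given as a representation of `G`; the passage between left and right modules is by inversion
in `G`, which affects none of the notions below. -/

section VerticesAndSources

variable {F : Type u} [Field F] {G : Type v} [Group G]
variable {V : Type w} [AddCommGroup V] [Module F V]

/-- The restriction of an `FG`-module to a subgroup `H`. -/
def resSubgroup (H : Subgroup G) (ρ : Representation F G V) : Representation F H V :=
  ρ.comp H.subtype

/-- An `FG`-module is indecomposable if it is non-zero and is not the direct sum of two non-zero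
submodules. -/
def IsIndecomposable (ρ : Representation F G V) : Prop :=
  Nontrivial V ∧ ∀ A B : Subrepresentation ρ, IsCompl A B → A = ⊥ ∨ B = ⊥

/-- `ρ` is isomorphic to a direct summand of `τ`: there is a split embedding of `ρ` into `τ`. -/
def IsSummandOf {W : Type*} [AddCommGroup W] [Module F W]
    (ρ : Representation F G V) (τ : Representation F G W) : Prop :=
  ∃ (i : ρ.IntertwiningMap τ) (p : τ.IntertwiningMap ρ), ∀ x : V, p (i x) = x

/-- `ρ` is relatively `H`-projective: it is a direct summand of a module induced from some
finite-dimensional `FH`-module.  (Every finite-dimensional `FH`-module has an isomorphic copy in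
the universe of `F`.) -/
def IsRelProjective (ρ : Representation F G V) (H : Subgroup G) : Prop :=
  ∃ (W : Type u) (_ : AddCommGroup W) (_ : Module F W) (σ : Representation F H W),
    Module.Finite F W ∧ IsSummandOf ρ (σ.ind H.subtype)

/-- `Q` is a vertex of `ρ`: the module is indecomposable, and `Q` is minimal among the subgroups
with respect to which it is relatively projective. -/
def IsVertex (ρ : Representation F G V) (Q : Subgroup G) : Prop :=
  IsIndecomposable ρ ∧ Minimal (IsRelProjective ρ) Q

/-- `σ` is a source of `ρ` with respect to the vertex `Q`: it is a (finite-dimensional)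
indecomposable `FQ`-module such that `ρ` is a direct summand of the module induced from `σ`. -/
def IsSource {W : Type*} [AddCommGroup W] [Module F W]
    (ρ : Representation F G V) (Q : Subgroup G) (σ : Representation F Q W) : Prop :=
  IsVertex ρ Q ∧ Module.Finite F W ∧ IsIndecomposable σ ∧ IsSummandOf ρ (σ.ind Q.subtype)

end VerticesAndSources

/-! The natural permutation module of the symmetric group `𝔖ₙ` and its simple subquotient. -/

section NaturalSimple

variable (F : Type u) [Field F] (n : ℕ)

/-- The natural permutation module `M` of `𝔖ₙ`, with permutation basis `γ₁, …, γₙ`, where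
`γᵢ = MonoidAlgebra.single i 1`. -/
noncomputable def permModule : Representation F (Perm (Fin n)) F[Fin n] :=
  Representation.ofMulAction F (Perm (Fin n)) (Fin n)

/-- The coefficient sum `∑ aᵢ γᵢ ↦ ∑ aᵢ`. -/
noncomputable def coeffSum : F[Fin n] →ₗ[F] F :=
  ∑ i : Fin n, Finsupp.lapply i ∘ₗ (MonoidAlgebra.coeffLinearEquiv F).toLinearMap

/-- `M' = {∑ aᵢ γᵢ | ∑ aᵢ = 0}`, which is the Specht module `S^{(n-1,1)}`. -/
noncomputable def sumZero : Submodule F F[Fin n] :=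
  LinearMap.ker (coeffSum F n)

/-- `M'' = {a ∑ γᵢ | a ∈ F}`, the orthogonal complement of `M'` in `M`. -/
noncomputable def constants : Submodule F F[Fin n] :=
  Submodule.span F {∑ i : Fin n, MonoidAlgebra.single i 1}

theorem coeffSum_perm (g : Perm (Fin n)) (x : F[Fin n]) :
    coeffSum F n (permModule F n g x) = coeffSum F n x := by
  suffices h : coeffSum F n ∘ₗ permModule F n g = coeffSum F n from LinearMap.congr_fun h x
  ext i
  simp [coeffSum, permModule, Finsupp.single_apply]

theorem sumZero_le_comap (g : Perm (Fin n)) :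
    sumZero F n ≤ (sumZero F n).comap (permModule F n g) := by
  intro x hx
  simpa [sumZero, coeffSum_perm] using hx

/-- `M'` as an `F𝔖ₙ`-module. -/
noncomputable def sumZeroModule : Representation F (Perm (Fin n)) (sumZero F n) :=
  (permModule F n).subrepresentation (sumZero F n) (sumZero_le_comap F n)

theorem constants_le_comap (g : Perm (Fin n)) :
    constants F n ≤ (constants F n).comap (permModule F n g) := by
  rw [constants, Submodule.span_le, Set.singleton_subset_iff]
  have h : permModule F n g (∑ i : Fin n, MonoidAlgebra.single i 1) =
      ∑ i : Fin n, MonoidAlgebra.single i 1 := by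
    simp only [permModule, map_sum, Representation.ofMulAction_single]
    exact Equiv.sum_comp g fun i => (MonoidAlgebra.single i 1 : F[Fin n])
  simp only [Submodule.comap_coe, Set.mem_preimage, SetLike.mem_coe, h]
  exact Submodule.mem_span_singleton_self _

theorem submoduleOf_le_comap (g : Perm (Fin n)) :
    (constants F n).submoduleOf (sumZero F n) ≤
      ((constants F n).submoduleOf (sumZero F n)).comap (sumZeroModule F n g) :=
  fun x hx => constants_le_comap F n g (x := (x : F[Fin n])) hx

/-- The underlying space of `D^{(n-1,1)}`: the quotient `M' / (M' ∩ M'')`.  If the characteristic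
of `F` divides `n` then `M'' ≤ M'`, so this is `M' / M''`. -/
abbrev NaturalSimple : Type u :=
  sumZero F n ⧸ (constants F n).submoduleOf (sumZero F n)

/-- The natural simple `F𝔖ₙ`-module `D^{(n-1,1)}`. -/
noncomputable def naturalSimple : Representation F (Perm (Fin n)) (NaturalSimple F n) :=
  (sumZeroModule F n).quotient ((constants F n).submoduleOf (sumZero F n))
    (submoduleOf_le_comap F n)

end NaturalSimple

/-! ### Fixed-point-free involutions and index-two subgroups of 2-groups. -/

section GroupTheory

/-! A Sylow 2-subgroup P centralizes a fixed-point-free involution θ, and contains the elementary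
abelian group E generated by the transpositions t_a = (a θ(a)). On D each t_a is a transvection d ↦
d + δ_a(d) v_a, where v_a is the class of γ_a + γ_{θ(a)} and δ_a(z) = z_a + z_{θ(a)}. The common
kernel of the δ_a is spanned by the v_a. An endomorphism commuting with E multiplies each v_a by
some scalar, and the relation ∑ v_a = 0 over the pairs forces all these scalars to agree
(`exists_scalar_of_commute`).

Indecomposability over P: every non-zero E-stable subspace meets this common kernel, where the
projection onto a direct summand is a scalar. It would have to be both 1 and 0.

Vertex: P has odd index, so D is relatively P-projective. Suppose Q < P also works. By Higman's
criterion the identity is a sum over G/Q of conjugates of one Q-endomorphism; evaluate it at some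
v_a. Cosets moved by E contribute 0, because traces from index-two subgroups of E vanish on D
(`exists_trace_eq_zero`). A coset fixed by E contributes a scalar, constant on P-orbits; P fixes no
coset as Q < P, so these orbits have even size and the scalars cancel in characteristic 2. Hence v_a
= 0, a contradiction (`le_of_isRelProjective`). -/

open MulAction in
/-- Every Sylow `2`-subgroup of a symmetric group of even degree centralizes a fixed-point-free
involution. -/
theorem exists_involution_centralized {n m : ℕ} (hm : n = 2 * m) (P : Sylow 2 (Perm (Fin n))) :
    ∃ θ : Perm (Fin n), (∀ a, θ a ≠ a) ∧ (∀ a, θ (θ a) = a) ∧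
      ∀ p ∈ (P : Subgroup (Perm (Fin n))), p * θ = θ * p := by
  obtain ⟨τ, hτ⟩ := (Equiv.Perm.exists_with_cycleType_iff (α := Fin n)
    (m := Multiset.replicate m 2)).2 ⟨by simp [hm, mul_comm],
      fun a ha => (Multiset.eq_of_mem_replicate ha).ge⟩
  have hfix : ∀ a, τ a ≠ a := by
    have hc : τ.support.card = Fintype.card (Fin n) := by
      rw [← Equiv.Perm.sum_cycleType, hτ]; simp [hm, mul_comm]
    intro a
    rw [← Equiv.Perm.mem_support, Finset.card_eq_iff_eq_univ _ |>.1 hc]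
    exact Finset.mem_univ a
  have hinv : τ ^ 2 = 1 := by
    rw [← orderOf_dvd_iff_pow_eq_one, ← Equiv.Perm.lcm_cycleType, hτ, Multiset.lcm_dvd]
    intro b hb
    rw [Multiset.eq_of_mem_replicate hb]
  -- Since (2m)! = 2^m m! (2m-1)!! and the centralizer of τ has order 2^m m!, its index is (2m-1)!!,
  -- a product of odd numbers.
  have hodd : ¬ 2 ∣ Nat.card (Perm (Fin n) ⧸ Subgroup.centralizer {τ}) := by
    have hcard : Nat.card (Subgroup.centralizer {τ}) = 2 ^ m * m.factorial := by
      rw [Equiv.Perm.nat_card_centralizer, hτ]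
      rcases Nat.eq_zero_or_pos m with h0 | h0
      · simp [h0, hm]
      · simp [hm, mul_comm, Multiset.toFinset_replicate, h0.ne']
    have hidx := Subgroup.card_mul_index (Subgroup.centralizer {τ})
    rw [hcard, Nat.card_eq_fintype_card, Fintype.card_perm, Fintype.card_fin] at hidx
    have hfac : n.factorial = 2 ^ m * m.factorial * (2 * m - 1).doubleFactorial := by
      rcases m with _ | k
      · simp [hm]
      · have h1 : 2 * (k + 1) = 2 * k + 1 + 1 := by ring
        rw [hm, h1, Nat.factorial_eq_mul_doubleFactorial, ← h1, Nat.doubleFactorial_two_mul]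
        rfl
    rw [hfac] at hidx
    have : (Subgroup.centralizer {τ}).index = (2 * m - 1).doubleFactorial :=
      Nat.eq_of_mul_eq_mul_left (by positivity) hidx
    rw [← Subgroup.index_eq_card, this, ← even_iff_two_dvd, Nat.not_even_iff_odd]
    rcases m with _ | k
    · simp
    · have h1 : 2 * (k + 1) - 1 = 2 * k + 1 := by omega
      rw [h1]
      clear * -
      induction k with
      | zero => simp
      | succ k ih =>
        rw [show 2 * (k + 1) + 1 = (2 * k + 1) + 2 by ring, Nat.doubleFactorial_add_two]
        exact Odd.mul ⟨k + 1, by ring⟩ ih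
  -- If P fixes the coset of g, then P centralizes the conjugate g τ g⁻¹.
  obtain ⟨c, hc⟩ := P.2.nonempty_fixed_point_of_prime_not_dvd_card
    (Perm (Fin n) ⧸ Subgroup.centralizer {τ}) hodd
  obtain ⟨g, rfl⟩ := QuotientGroup.mk_surjective c
  refine ⟨g * τ * g⁻¹, fun a h => hfix (g⁻¹ a) ?_, fun a => ?_, fun p hp => ?_⟩
  · exact g.injective (by simpa using h)
  · have h2 : (g * τ * g⁻¹) ^ 2 = 1 := by rw [conj_pow, hinv, mul_one, mul_inv_cancel]
    exact Equiv.Perm.congr_fun (pow_two (g * τ * g⁻¹) ▸ h2) a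
  · have h := hc ⟨p⁻¹, inv_mem hp⟩
    change ((p⁻¹ * g : Perm (Fin n)) : Perm (Fin n) ⧸ Subgroup.centralizer {τ}) = (g : _ ⧸ _) at h
    rw [QuotientGroup.eq, Subgroup.mem_centralizer_singleton_iff] at h
    have h2 : g * (((p⁻¹ * g)⁻¹ * g) * τ) * g⁻¹ = g * (τ * ((p⁻¹ * g)⁻¹ * g)) * g⁻¹ := by
      rw [h]
    simpa [mul_assoc] using h2

/-- In a finite `2`-group every proper subgroup lies in a subgroup of index `2`. -/
theorem IsPGroup.exists_index_two {E : Type*} [Group E] [Finite E] (hE : IsPGroup 2 E)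
    {H : Subgroup E} (hH : H ≠ ⊤) : ∃ K : Subgroup E, K.index = 2 ∧ H ≤ K := by
  have : Fact (Nat.Prime 2) := ⟨Nat.prime_two⟩
  obtain ⟨k, hk⟩ := IsPGroup.iff_card.1 hE
  obtain ⟨l, hl⟩ := IsPGroup.iff_card.1 (hE.to_subgroup H)
  have hlt : 2 ^ l < 2 ^ k := by
    rw [← hk, ← hl]
    exact lt_of_le_of_ne (Subgroup.card_le_card_group H)
      fun h => hH (Subgroup.eq_top_of_card_eq H h)
  have hlk : l < k := (Nat.pow_lt_pow_iff_right (by norm_num)).1 hlt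
  obtain ⟨j, rfl⟩ : ∃ j, k = j + 1 := ⟨k - 1, by omega⟩
  obtain ⟨K, hK, hHK⟩ := Sylow.exists_subgroup_card_pow_prime_le 2 (m := j)
    (hk ▸ pow_dvd_pow 2 j.le_succ) H hl (by omega)
  refine ⟨K, ?_, hHK⟩
  have := K.card_mul_index
  rw [hK, hk, pow_succ] at this
  exact Nat.eq_of_mul_eq_mul_left (by positivity) this

end GroupTheory

/-! ### Cancellation of equivariant sums over orbits of a 2-group. -/

section SumOverActions

variable {F : Type*} [Field F] {E X D : Type*} [Group E] [MulAction E X]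
  [AddCommGroup D] [Module F D]

-- Choose K of index 2 containing the stabilizer of x. The orbit of x is then the disjoint union of
-- the K-orbit and its translate by any e outside K, so the orbit sum is z + e z for a K-fixed z.
open Classical in
theorem sum_orbit_eq_zero [Finite E] (hE : IsPGroup 2 E) (ρ : Representation F E D) (f : X → D)
    (S : Finset X) (hS : ∀ (e : E), ∀ x ∈ S, e • x ∈ S)
    (hf : ∀ (e : E), ∀ x ∈ S, f (e • x) = ρ e (f x))
    (hK : ∀ K : Subgroup E, K.index = 2 → ∀ z, (∀ k ∈ K, ρ k z = z) → ∃ e ∉ K, z + ρ e z = 0)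
    {x : X} (hx : x ∈ S) (hfix : ∃ e : E, e • x ≠ x) :
    ∑ y ∈ S with y ∈ MulAction.orbit E x, f y = 0 := by
  obtain ⟨K, hK2, hle⟩ := hE.exists_index_two (H := MulAction.stabilizer E x) (by
    obtain ⟨e, he⟩ := hfix
    exact fun h => he (MulAction.mem_stabilizer_iff.1 (h ▸ Subgroup.mem_top e)))
  set A : Finset X := {y ∈ S | ∃ k ∈ K, k • x = y} with hA
  have hAS : ∀ y ∈ A, y ∈ S := fun y hy => (Finset.mem_filter.1 hy).1
  have hshift : ∀ e : E, ρ e (∑ y ∈ A, f y) = ∑ y ∈ A.image (e • ·), f y := by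
    intro e
    rw [map_sum, Finset.sum_image (fun a _ b _ h => MulAction.injective e h)]
    exact Finset.sum_congr rfl fun y hy => (hf e y (hAS y hy)).symm
  have hinv : ∀ k ∈ K, ρ k (∑ y ∈ A, f y) = ∑ y ∈ A, f y := by
    intro k hk
    rw [hshift]
    congr 1
    refine Finset.eq_of_subset_of_card_le ?_
      (Finset.card_image_of_injective _ (MulAction.injective k)).ge
    intro y hy
    obtain ⟨y', hy', rfl⟩ := Finset.mem_image.1 hy
    obtain ⟨hy'S, k', hk', rfl⟩ := Finset.mem_filter.1 hy'
    exact Finset.mem_filter.2 ⟨hS _ _ hy'S, k * k', mul_mem hk hk', mul_smul _ _ _⟩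
  obtain ⟨e, he, hz⟩ := hK K hK2 _ hinv
  rw [hshift, ← Finset.sum_union] at hz
  · rw [← hz]
    refine Finset.sum_congr (Finset.ext fun y => ?_) fun _ _ => rfl
    simp only [Finset.mem_filter, Finset.mem_union, Finset.mem_image, hA]
    constructor
    · rintro ⟨hyS, g, rfl⟩
      by_cases hg : g ∈ K
      · exact Or.inl ⟨hyS, g, hg, rfl⟩
      · refine Or.inr ⟨(e⁻¹ * g) • x, ⟨hS _ _ hx, _, ?_, rfl⟩, by simp [mul_smul]⟩
        rw [Subgroup.mul_mem_iff_of_index_two hK2, inv_mem_iff]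
        tauto
    · rintro (⟨hyS, k, -, rfl⟩ | ⟨_, ⟨hyS, k, -, rfl⟩, rfl⟩)
      · exact ⟨hyS, k, rfl⟩
      · exact ⟨hS _ _ hyS, e * k, mul_smul _ _ _⟩
  -- If the two halves met, k⁻¹ e k' would stabilize x and so lie in K, forcing e into K.
  · rw [Finset.disjoint_left]
    intro y hy hy'
    obtain ⟨-, k, hk, rfl⟩ := Finset.mem_filter.1 hy
    obtain ⟨_, hy'', hke⟩ := Finset.mem_image.1 hy'
    obtain ⟨-, k', hk', rfl⟩ := Finset.mem_filter.1 hy''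
    have hst : k⁻¹ * (e * k') ∈ K := hle (by
      rw [MulAction.mem_stabilizer_iff, mul_smul, mul_smul]
      exact (congrArg (k⁻¹ • ·) hke).trans (inv_smul_smul k x))
    rw [Subgroup.mul_mem_cancel_left _ (inv_mem hk), Subgroup.mul_mem_cancel_right _ hk'] at hst
    exact he hst

open Classical in
/-- Let a finite `2`-group `E` act without fixed points on a finite set `S`, and let `f` be an
equivariant map from `S` to an `FE`-module `D` such that the relative traces from all subgroups
of index `2` vanish on `D`. Then the values of `f` sum to zero. -/
theorem sum_eq_zero_of_trace_eq_zero [Finite E] (hE : IsPGroup 2 E) (ρ : Representation F E D)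
    (f : X → D)
    (hK : ∀ K : Subgroup E, K.index = 2 → ∀ z, (∀ k ∈ K, ρ k z = z) → ∃ e ∉ K, z + ρ e z = 0)
    (S : Finset X) (hS : ∀ (e : E), ∀ x ∈ S, e • x ∈ S)
    (hf : ∀ (e : E), ∀ x ∈ S, f (e • x) = ρ e (f x))
    (hfix : ∀ x ∈ S, ∃ e : E, e • x ≠ x) : ∑ x ∈ S, f x = 0 := by
  induction S using Finset.strongInduction with
  | H S ih =>
    rcases S.eq_empty_or_nonempty with rfl | ⟨x, hx⟩
    · simp
    · rw [← Finset.sum_filter_add_sum_filter_not S (· ∈ MulAction.orbit E x),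
        sum_orbit_eq_zero hE ρ f S hS hf hK hx (hfix x hx), zero_add]
      refine ih _ ?_ ?_ ?_ ?_
      · refine Finset.filter_ssubset.2 ⟨x, hx, ?_⟩
        simp [MulAction.mem_orbit_self]
      · intro e y hy
        rw [Finset.mem_filter] at hy ⊢
        exact ⟨hS e y hy.1, fun ⟨g, hg⟩ => hy.2
          ⟨e⁻¹ * g, (mul_smul _ _ _).trans (inv_smul_eq_iff.2 hg)⟩⟩
      · exact fun e y hy => hf e y (Finset.mem_filter.1 hy).1
      · exact fun y hy => hfix y (Finset.mem_filter.1 hy).1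

end SumOverActions

/-! ### Higman's criterion and induction from subgroups of invertible index. -/

section RelativeTrace

variable {F : Type u} [Field F] {G : Type v} [Group G]
variable {V : Type w} [AddCommGroup V] [Module F V]

/-- The conjugate `ρ(g) φ ρ(g)⁻¹` of an endomorphism of an `FG`-module. -/
def conjEnd (ρ : Representation F G V) (φ : V →ₗ[F] V) (g : G) : V →ₗ[F] V :=
  ρ g ∘ₗ φ ∘ₗ ρ g⁻¹

theorem conjEnd_apply (ρ : Representation F G V) (φ : V →ₗ[F] V) (g : G) (x : V) :
    conjEnd ρ φ g x = ρ g (φ (ρ g⁻¹ x)) := rfl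

theorem conjEnd_mul (ρ : Representation F G V) (φ : V →ₗ[F] V) (g h : G) (x : V) :
    conjEnd ρ φ (g * h) (ρ g x) = ρ g (conjEnd ρ φ h x) := by
  simp [conjEnd_apply]

/-- Two representatives of a coset differ by an element of Q, which commutes with φ. Conjugates are
thus indexed by G/Q, whatever representatives `out` selects. -/
theorem conjEnd_out (ρ : Representation F G V) {Q : Subgroup G} {φ : V →ₗ[F] V}
    (hφ : ∀ q ∈ Q, ∀ x, φ (ρ q x) = ρ q (φ x)) (g : G) :
    conjEnd ρ φ (g : G ⧸ Q).out = conjEnd ρ φ g := by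
  obtain ⟨q, hq⟩ := QuotientGroup.mk_out_eq_mul Q g
  ext x
  rw [hq, conjEnd_apply, conjEnd_apply, mul_inv_rev, map_mul, map_mul, Module.End.mul_apply,
    Module.End.mul_apply, hφ _ (inv_mem q.2)]
  simp

theorem conjEnd_smul_out (ρ : Representation F G V) {Q : Subgroup G} {φ : V →ₗ[F] V}
    (hφ : ∀ q ∈ Q, ∀ x, φ (ρ q x) = ρ q (φ x)) (g : G) (c : G ⧸ Q) (x : V) :
    conjEnd ρ φ (g • c).out (ρ g x) = ρ g (conjEnd ρ φ c.out x) := by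
  obtain ⟨h, rfl⟩ := QuotientGroup.mk_surjective c
  rw [MulAction.Quotient.smul_coe, conjEnd_out ρ hφ, conjEnd_out ρ hφ, smul_eq_mul, conjEnd_mul]

theorem indV_mk_mul {W : Type*} [AddCommGroup W] [Module F W] {Q : Subgroup G}
    (σ : Representation F Q W) (q : Q) (h : G) (w : W) :
    Representation.IndV.mk Q.subtype σ (q * h) (σ q w) =
      Representation.IndV.mk Q.subtype σ h w := by
  have := Representation.Coinvariants.mk_self_apply
    (Representation.tprod ((Representation.leftRegular F G).comp Q.subtype) σ) q
    (TensorProduct.tmul F (MonoidAlgebra.single h 1) w)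
  rw [Representation.tprod_apply, TensorProduct.map_tmul, MonoidHom.comp_apply,
    Representation.ofMulAction_single] at this
  exact this

open Classical in
/-- The projection of an induced module onto the summand `1 ⊗ W`. -/
noncomputable def indProj {W : Type*} [AddCommGroup W] [Module F W] (Q : Subgroup G)
    (σ : Representation F Q W) :
    Representation.IndV Q.subtype σ →ₗ[F] Representation.IndV Q.subtype σ :=
  Representation.Coinvariants.lift _
    (TensorProduct.lift (Finsupp.lift _ F G
      (fun h => if h ∈ Q then Representation.IndV.mk Q.subtype σ h else 0) ∘ₗ
        (MonoidAlgebra.coeffLinearEquiv F).toLinearMap)) (by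
    intro q
    ext h w
    have hm : (q : G) * h ∈ Q ↔ h ∈ Q := Subgroup.mul_mem_cancel_left _ q.2
    by_cases hh : h ∈ Q
    · have := indV_mk_mul σ q h w
      simpa [hm, hh] using this
    · simp [hm, hh])

open Classical in
theorem indProj_mk {W : Type*} [AddCommGroup W] [Module F W] (Q : Subgroup G)
    (σ : Representation F Q W) (h : G) (w : W) :
    indProj Q σ (Representation.IndV.mk Q.subtype σ h w) =
      if h ∈ Q then Representation.IndV.mk Q.subtype σ h w else 0 := by
  by_cases hh : h ∈ Q
  · simp [indProj, hh]
  · simp [indProj, hh]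

theorem ind_mk_apply {W : Type*} [AddCommGroup W] [Module F W] (Q : Subgroup G)
    (σ : Representation F Q W) (g h : G) (w : W) :
    σ.ind Q.subtype g (Representation.IndV.mk Q.subtype σ h w) =
      Representation.IndV.mk Q.subtype σ (h * g⁻¹) w :=
  Representation.ind_mk _ _ _ _ _

theorem indProj_comm {W : Type*} [AddCommGroup W] [Module F W] (Q : Subgroup G)
    (σ : Representation F Q W) {q : G} (hq : q ∈ Q) (x : Representation.IndV Q.subtype σ) :
    indProj Q σ (σ.ind Q.subtype q x) = σ.ind Q.subtype q (indProj Q σ x) := by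
  suffices h : indProj Q σ ∘ₗ σ.ind Q.subtype q = σ.ind Q.subtype q ∘ₗ indProj Q σ from
    LinearMap.congr_fun h x
  refine Representation.IndV.hom_ext _ _ fun h => LinearMap.ext fun w => ?_
  simp only [LinearMap.comp_apply (f := indProj Q σ), LinearMap.comp_apply (f := σ.ind Q.subtype q),
    LinearMap.comp_apply (g := Representation.IndV.mk Q.subtype σ h)]
  rw [ind_mk_apply, indProj_mk, indProj_mk]
  have hm : h * q⁻¹ ∈ Q ↔ h ∈ Q := Subgroup.mul_mem_cancel_right _ (inv_mem hq)
  by_cases hh : h ∈ Q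
  · rw [if_pos hh, if_pos (hm.2 hh), ind_mk_apply]
  · rw [if_neg hh, if_neg (hm.not.2 hh), map_zero]

theorem sum_conjEnd_indProj {W : Type*} [AddCommGroup W] [Module F W] (Q : Subgroup G)
    [Fintype (G ⧸ Q)] (σ : Representation F Q W) :
    ∑ c : G ⧸ Q, conjEnd (σ.ind Q.subtype) (indProj Q σ) c.out = LinearMap.id := by
  refine Representation.IndV.hom_ext _ _ fun h => LinearMap.ext fun w => ?_
  change (∑ c : G ⧸ Q, conjEnd (σ.ind Q.subtype) (indProj Q σ) c.out)
    (Representation.IndV.mk Q.subtype σ h w) = Representation.IndV.mk Q.subtype σ h w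
  -- As g sends `mk h w` to `mk (h * g⁻¹) w`, the conjugate projection at c keeps `mk h w` exactly
  -- when h c meets Q, that is, when c is the coset of h⁻¹.
  rw [LinearMap.sum_apply, Finset.sum_eq_single ((h⁻¹ : G) : G ⧸ Q)]
  · rw [conjEnd_out _ fun q hq x => indProj_comm Q σ hq x, conjEnd_apply, ind_mk_apply, indProj_mk,
      if_pos (by simp [one_mem]), ind_mk_apply]
    simp
  · intro c _ hc
    rw [conjEnd_apply, ind_mk_apply, indProj_mk, if_neg, map_zero]
    intro hmem
    refine hc ?_
    rw [← QuotientGroup.out_eq' c, eq_comm, QuotientGroup.eq]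
    simpa using hmem
  · simp

/-- Higman's criterion: the identity of a relatively `Q`-projective module is the relative trace
of a `Q`-endomorphism. -/
theorem IsRelProjective.exists_trace_eq_id {ρ : Representation F G V} {Q : Subgroup G}
    [Fintype (G ⧸ Q)] (h : IsRelProjective ρ Q) :
    ∃ φ : V →ₗ[F] V, (∀ q ∈ Q, ∀ x, φ (ρ q x) = ρ q (φ x)) ∧
      ∀ x, ∑ c : G ⧸ Q, conjEnd ρ φ c.out x = x := by
  obtain ⟨W, _, _, σ, -, i, p, hip⟩ := h
  refine ⟨p.toLinearMap ∘ₗ indProj Q σ ∘ₗ i.toLinearMap, fun q hq x => ?_, fun x => ?_⟩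
  · change p (indProj Q σ (i (ρ q x))) = ρ q (p (indProj Q σ (i x)))
    rw [i.isIntertwining, indProj_comm Q σ hq, p.isIntertwining]
  · have := LinearMap.congr_fun (sum_conjEnd_indProj Q σ) (i x)
    rw [LinearMap.sum_apply, LinearMap.id_apply] at this
    conv_rhs => rw [← hip x, ← this, map_sum]
    refine Finset.sum_congr rfl fun c _ => ?_
    change ρ _ (p (indProj Q σ (i (ρ _ x)))) = p (_)
    rw [i.isIntertwining, conjEnd_apply, p.isIntertwining]

/-- The canonical map from an induced restriction, `g ⊗ x ↦ g⁻¹ x`. -/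
noncomputable def indResCounit (ρ : Representation F G V) (H : Subgroup G) :
    ((resSubgroup H ρ).ind H.subtype).IntertwiningMap ρ where
  toLinearMap := Representation.Coinvariants.lift _
    (TensorProduct.lift (Finsupp.lift _ F G (fun h => ρ h⁻¹) ∘ₗ
      (MonoidAlgebra.coeffLinearEquiv F).toLinearMap)) (by
      intro q
      ext h x
      simp [resSubgroup])
  isIntertwining' g := by
    refine Representation.IndV.hom_ext _ _ fun h => LinearMap.ext fun x => ?_
    simp

theorem indResCounit_mk (ρ : Representation F G V) (H : Subgroup G) (h : G) (x : V) :
    indResCounit ρ H (Representation.IndV.mk H.subtype (resSubgroup H ρ) h x) = ρ h⁻¹ x := by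
  rw [← Representation.IntertwiningMap.toLinearMap_apply]
  simp [indResCounit]

/-- A module is a direct summand of the module induced from its restriction to a subgroup whose
index is invertible. -/
theorem isSummandOf_ind_res (ρ : Representation F G V) (H : Subgroup G) [Finite G]
    (hH : (H.index : F) ≠ 0) : IsSummandOf ρ ((resSubgroup H ρ).ind H.subtype) := by
  have := Fintype.ofFinite (G ⧸ H)
  -- M g sends x to g ⊗ g⁻¹x up to the inversion built into `mk`. It depends only on gH, and
  -- averaging it over G/H splits the counit.
  let M : G → V →ₗ[F] Representation.IndV H.subtype (resSubgroup H ρ) := fun g =>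
    Representation.IndV.mk H.subtype (resSubgroup H ρ) g⁻¹ ∘ₗ ρ g⁻¹
  have hM : ∀ g : G, M (g : G ⧸ H).out = M g := by
    intro g
    obtain ⟨q, hq⟩ := QuotientGroup.mk_out_eq_mul H g
    ext x
    have := indV_mk_mul (resSubgroup H ρ) q⁻¹ g⁻¹ (ρ g⁻¹ x)
    rw [hq]
    simp only [M, mul_inv_rev, map_mul]
    exact this
  refine ⟨((H.index : F)⁻¹ • ∑ c : G ⧸ H, M c.out).intertwiningMap_of_isIntertwiningMap _ _ ?_,
    indResCounit ρ H, fun x => ?_⟩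
  · intro g x
    rw [LinearMap.smul_apply, LinearMap.smul_apply, map_smul, LinearMap.sum_apply,
      LinearMap.sum_apply, map_sum]
    congr 1
    refine (Fintype.sum_equiv (MulAction.toPerm g) _ _ fun c => ?_).symm
    obtain ⟨h, rfl⟩ := QuotientGroup.mk_surjective c
    rw [MulAction.toPerm_apply, MulAction.Quotient.smul_coe, hM, hM]
    change _ = Representation.IndV.mk H.subtype _ (g • h)⁻¹ (ρ (g • h)⁻¹ (ρ g x))
    refine (ind_mk_apply H (resSubgroup H ρ) g h⁻¹ (ρ h⁻¹ x)).trans ?_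
    simp
  · rw [LinearMap.toIntertwiningMap, LinearMap.smul_apply, LinearMap.sum_apply, map_smul, map_sum]
    have : ∀ c : G ⧸ H, indResCounit ρ H (M c.out x) = x := by
      intro c
      simp only [M]
      rw [LinearMap.comp_apply, indResCounit_mk]
      simp
    simp only [this, Finset.sum_const, Finset.card_univ, ← Nat.card_eq_fintype_card,
      ← Subgroup.index_eq_card]
    rw [← Nat.cast_smul_eq_nsmul F, smul_smul, inv_mul_cancel₀ hH, one_smul]

end RelativeTrace

/-! ### Coordinates on D and transpositions as transvections. -/

section Coordinates

variable (F : Type u) [Field F] (n : ℕ)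

/-- Coordinate vectors with coefficient sum zero. -/
def zeroSum : Submodule F (Fin n → F) :=
  LinearMap.ker (∑ i : Fin n, LinearMap.proj i)

variable {F n} in
theorem mem_zeroSum {z : Fin n → F} : z ∈ zeroSum F n ↔ ∑ i, z i = 0 := by
  simp [zeroSum]

/-- The element of the group algebra with given coordinates. -/
noncomputable def ofCoords : (Fin n → F) ≃ₗ[F] F[Fin n] :=
  (Finsupp.linearEquivFunOnFinite F F (Fin n)).symm ≪≫ₗ (MonoidAlgebra.coeffLinearEquiv F).symm

theorem coeff_ofCoords (z : Fin n → F) (i : Fin n) : (ofCoords F n z).coeff i = z i := rfl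

theorem mem_sumZero_iff (x : F[Fin n]) : x ∈ sumZero F n ↔ ∑ i, x.coeff i = 0 := by
  simp [sumZero, coeffSum]

/-- The class in `D^{(n-1,1)}` of a coordinate vector with coefficient sum zero. -/
noncomputable def natClass : zeroSum F n →ₗ[F] NaturalSimple F n :=
  Submodule.mkQ _ ∘ₗ (ofCoords F n).toLinearMap.restrict (q := sumZero F n) (fun z hz => by
    rw [mem_sumZero_iff]
    exact mem_zeroSum.1 hz)

variable {F n}

theorem natClass_surjective : Function.Surjective (natClass F n) := by
  intro d
  obtain ⟨x, rfl⟩ := Submodule.mkQ_surjective _ d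
  refine ⟨⟨(ofCoords F n).symm x, mem_zeroSum.2 ((mem_sumZero_iff F n _).1 x.2)⟩, ?_⟩
  refine congrArg (Submodule.mkQ _) (Subtype.ext ?_)
  exact (ofCoords F n).apply_symm_apply x

theorem natClass_eq_zero_iff (z : zeroSum F n) :
    natClass F n z = 0 ↔ ∃ c : F, ∀ i, (z : Fin n → F) i = c := by
  have hone : ∑ i : Fin n, (MonoidAlgebra.single i 1 : F[Fin n]) = ofCoords F n 1 := by
    ext i
    simp [coeff_ofCoords, Finsupp.single_apply, MonoidAlgebra.coeff_sum]
  refine (Submodule.Quotient.mk_eq_zero _).trans ?_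
  change ofCoords F n z ∈ constants F n ↔ _
  rw [constants, Submodule.mem_span_singleton]
  refine exists_congr fun c => ?_
  change c • _ = ofCoords F n z ↔ _
  rw [hone, ← map_smul, (ofCoords F n).injective.eq_iff]
  constructor
  · intro h i
    rw [← h]
    simp
  · intro h
    ext i
    simp [h]

theorem naturalSimple_natClass (g : Perm (Fin n)) (z z' : zeroSum F n)
    (h : ∀ i, (z' : Fin n → F) (g i) = (z : Fin n → F) i) :
    naturalSimple F n g (natClass F n z) = natClass F n z' := by
  refine congrArg (Submodule.mkQ _) (Subtype.ext ?_)
  change permModule F n g (ofCoords F n z) = ofCoords F n z'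
  ext i
  rw [permModule, Representation.coeff_ofMulAction, coeff_ofCoords, coeff_ofCoords, ← h]
  simp

/-- The functional `z ↦ z a + z b` on `D^{(n-1,1)}` in characteristic `2`. -/
noncomputable def pairFunctional [CharP F 2] (a b : Fin n) : NaturalSimple F n →ₗ[F] F :=
  Submodule.liftQ _
    (({ toFun := fun z => z a + z b
        map_add' := fun _ _ => add_add_add_comm _ _ _ _
        map_smul' := fun _ _ => (mul_add _ _ _).symm } : (Fin n → F) →ₗ[F] F) ∘ₗ
      (ofCoords F n).symm.toLinearMap ∘ₗ (sumZero F n).subtype) (by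
    intro x hx
    have h : natClass F n ⟨(ofCoords F n).symm x,
        mem_zeroSum.2 ((mem_sumZero_iff F n _).1 x.2)⟩ = 0 :=
      (congrArg (Submodule.mkQ _) (Subtype.ext ((ofCoords F n).apply_symm_apply x))).trans
        ((Submodule.Quotient.mk_eq_zero _).2 hx)
    obtain ⟨c, hc⟩ := (natClass_eq_zero_iff _).1 h
    have hc' : ∀ i, (ofCoords F n).symm x i = c := hc
    exact (congrArg₂ (· + ·) (hc' a) (hc' b)).trans (CharTwo.add_self_eq_zero c))

theorem pairFunctional_natClass [CharP F 2] (a b : Fin n) (z : zeroSum F n) :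
    pairFunctional a b (natClass F n z) = (z : Fin n → F) a + (z : Fin n → F) b := rfl

/-- The vector `γ_a + γ_b` in characteristic `2`. -/
def pairVec [CharP F 2] (a b : Fin n) : zeroSum F n :=
  ⟨Pi.single a 1 + Pi.single b 1, mem_zeroSum.2 (by
    simp [Finset.sum_add_distrib, CharTwo.add_self_eq_zero])⟩

theorem pairVec_apply [CharP F 2] (a b i : Fin n) :
    (pairVec a b : zeroSum F n).1 i = (if i = a then 1 else 0) + (if i = b then 1 else 0) := by
  simp [pairVec, Pi.single_apply]

theorem naturalSimple_pairVec [CharP F 2] (g : Perm (Fin n)) (a b : Fin n) :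
    naturalSimple F n g (natClass F n (pairVec a b)) = natClass F n (pairVec (g a) (g b)) := by
  refine naturalSimple_natClass _ _ _ fun i => ?_
  simp [pairVec_apply]

/-- In characteristic 2, exchanging the coordinates z_a and z_b amounts to adding z_a + z_b to both.
-/
theorem naturalSimple_swap [CharP F 2] {a b : Fin n} (hab : b ≠ a) (d : NaturalSimple F n) :
    naturalSimple F n (Equiv.swap a b) d =
      d + pairFunctional a b d • natClass F n (pairVec a b) := by
  obtain ⟨z, rfl⟩ := natClass_surjective d
  rw [pairFunctional_natClass, ← map_smul, ← map_add]
  refine naturalSimple_natClass _ _ _ fun i => ?_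
  change (z : Fin n → F) (Equiv.swap a b i) +
    ((z : Fin n → F) a + (z : Fin n → F) b) * (pairVec a b : zeroSum F n).1 _ = _
  rw [pairVec_apply]
  rcases eq_or_ne i a with rfl | hia
  · simp only [Equiv.swap_apply_left, if_neg hab, if_true]
    linear_combination CharTwo.add_self_eq_zero ((z : Fin n → F) b)
  · rcases eq_or_ne i b with rfl | hib
    · simp only [Equiv.swap_apply_right, if_neg hab.symm, if_true]
      linear_combination CharTwo.add_self_eq_zero ((z : Fin n → F) a)
    · simp [Equiv.swap_apply_of_ne_of_ne hia hib, hia, hib]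

end Coordinates

/-! ### The pair group of θ and its action on D. -/

section Pairing

variable {F : Type u} [Field F] [CharP F 2] {n : ℕ} {θ : Perm (Fin n)}

theorem sum_eq_sum_pairs {A : Type*} [AddCommMonoid A] (hfix : ∀ a, θ a ≠ a)
    (hinv : ∀ a, θ (θ a) = a) (f : Fin n → A) :
    ∑ i, f i = ∑ a with a < θ a, (f a + f (θ a)) := by
  rw [← Finset.sum_filter_add_sum_filter_not Finset.univ (fun a => a < θ a),
    Finset.sum_add_distrib]
  congr 1
  refine Finset.sum_nbij' θ θ ?_ ?_ ?_ ?_ ?_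
  · intro a ha
    simp only [Finset.mem_filter, Finset.mem_univ, true_and, hinv] at ha ⊢
    exact lt_of_le_of_ne (not_lt.1 ha) (hfix a)
  · intro a ha
    simp only [Finset.mem_filter, Finset.mem_univ, true_and, hinv] at ha ⊢
    exact ha.le.not_gt
  · simp [hinv]
  · simp [hinv]
  · simp [hinv]

theorem sum_smul_pairVec (hfix : ∀ a, θ a ≠ a) (hinv : ∀ a, θ (θ a) = a) (z : Fin n → F)
    (hz : ∀ a, z (θ a) = z a) :
    ((∑ a with a < θ a, z a • pairVec a (θ a) : zeroSum F n) : Fin n → F) = z := by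
  ext i
  have h := sum_eq_sum_pairs hfix hinv fun a => z a * (if i = a then 1 else 0)
  rw [Finset.sum_eq_single i (by simp +contextual [eq_comm]) (by simp)] at h
  rw [if_pos rfl, mul_one] at h
  rw [h, Submodule.coe_sum, Finset.sum_apply]
  refine Finset.sum_congr rfl fun a _ => ?_
  rw [hz, ← mul_add, ← pairVec_apply]
  rfl

theorem exists_notMem_pairs (hn : 4 < n) (a b c d : Fin n) :
    ∃ i, i ≠ a ∧ i ≠ b ∧ i ≠ c ∧ i ≠ d := by
  have hlt : ({a, b, c, d} : Finset (Fin n)).card < (Finset.univ : Finset (Fin n)).card := by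
    rw [Finset.card_univ, Fintype.card_fin]
    exact Finset.card_le_four.trans_lt hn
  obtain ⟨i, -, hi⟩ := Finset.exists_mem_notMem_of_card_lt_card hlt
  simp only [Finset.mem_insert, Finset.mem_singleton, not_or] at hi
  exact ⟨i, hi⟩

/-- Since n > 4 some index lies outside both pairs. The combination vanishes there, so the constant
vector it represents is 0. -/
theorem pairClass_independent (hn : 4 < n) {a b : Fin n} (hfix : ∀ a, θ a ≠ a)
    (hinv : ∀ a, θ (θ a) = a) (hba : b ≠ a) (hba' : b ≠ θ a) {x y : F}
    (h : x • natClass F n (pairVec a (θ a)) + y • natClass F n (pairVec b (θ b)) = 0) :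
    x = 0 ∧ y = 0 := by
  rw [← map_smul, ← map_smul, ← map_add, natClass_eq_zero_iff] at h
  obtain ⟨c, hc⟩ := h
  obtain ⟨i, hia, hia', hib, hib'⟩ := exists_notMem_pairs hn a (θ a) b (θ b)
  replace hc : ∀ i, x * (pairVec a (θ a) : zeroSum F n).1 i +
    y * (pairVec b (θ b) : zeroSum F n).1 i = c := hc
  have hab' : a ≠ θ b := fun h => hba' (by rw [h, hinv])
  have h0 := hc i
  have h1 := hc a
  have h2 := hc b
  simp only [pairVec_apply, if_neg hia, if_neg hia', if_neg hib, if_neg hib', if_neg hba,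
    if_neg hba', if_neg hba.symm, if_neg hab', if_neg (hfix a).symm, if_neg (hfix b).symm,
    if_true, mul_zero, add_zero, mul_one, zero_add] at h0 h1 h2
  exact ⟨h1.trans h0.symm, h2.trans h0.symm⟩

theorem pairClass_ne_zero (hn : 4 < n) (hfix : ∀ a, θ a ≠ a) (a : Fin n) :
    natClass F n (pairVec a (θ a)) ≠ 0 := by
  intro h
  obtain ⟨c, hc⟩ := (natClass_eq_zero_iff _).1 h
  obtain ⟨i, hia, hia', -⟩ := exists_notMem_pairs hn a (θ a) a a
  have h0 := hc i
  have h1 := hc a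
  rw [pairVec_apply] at h0 h1
  simp only [if_neg hia, if_neg hia', if_neg (hfix a).symm, if_true, add_zero] at h0 h1
  exact one_ne_zero (h1.trans h0.symm)

/-- The coordinates of γ_b + γ_{θ(b)} are θ-invariant. With `naturalSimple_swap` this says that
every t_a fixes every v_b. -/
theorem pairFunctional_pairClass (hinv : ∀ a, θ (θ a) = a) (a b : Fin n) :
    pairFunctional a (θ a) (natClass F n (pairVec b (θ b))) = 0 := by
  rw [pairFunctional_natClass, pairVec_apply, pairVec_apply]
  have h1 : θ a = b ↔ a = θ b := ⟨fun h => by rw [← h, hinv], fun h => by rw [h, hinv]⟩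
  simp only [θ.injective.eq_iff, h1]
  rw [add_comm (if a = θ b then (1 : F) else 0), CharTwo.add_self_eq_zero]

/-- A vector killed by all pair functionals is a combination of the pair sums. -/
theorem eq_sum_pairClass (hfix : ∀ a, θ a ≠ a) (hinv : ∀ a, θ (θ a) = a) {d : NaturalSimple F n}
    (hd : ∀ a, pairFunctional a (θ a) d = 0) :
    ∃ z : Fin n → F, d = ∑ a with a < θ a, z a • natClass F n (pairVec a (θ a)) := by
  obtain ⟨z, rfl⟩ := natClass_surjective d
  refine ⟨z, ?_⟩
  have hz : ∀ a, (z : Fin n → F) (θ a) = (z : Fin n → F) a := fun a => by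
    have := hd a
    rw [pairFunctional_natClass, CharTwo.add_eq_zero] at this
    exact this.symm
  conv_lhs => rw [← Subtype.ext (sum_smul_pairVec hfix hinv _ hz), map_sum]
  simp only [map_smul]

theorem sum_pairFunctional (hfix : ∀ a, θ a ≠ a) (hinv : ∀ a, θ (θ a) = a)
    (d : NaturalSimple F n) : ∑ a with a < θ a, pairFunctional a (θ a) d = 0 := by
  obtain ⟨z, rfl⟩ := natClass_surjective d
  simp only [pairFunctional_natClass]
  rw [← sum_eq_sum_pairs hfix hinv]
  exact mem_zeroSum.1 z.2

theorem exists_pairFunctional_eq_one (hn : 4 < n) (hfix : ∀ a, θ a ≠ a) (a : Fin n) :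
    ∃ d : NaturalSimple F n, pairFunctional a (θ a) d = 1 := by
  obtain ⟨i, hia, hia', -⟩ := exists_notMem_pairs hn a (θ a) a a
  refine ⟨natClass F n (pairVec a i), ?_⟩
  simp [pairFunctional_natClass, pairVec_apply, hfix a, hia.symm, hia'.symm]

/-- An endomorphism commuting with the transpositions `(a θ(a))` acts as a scalar on their common
fixed space. -/
theorem exists_scalar_of_commute (hn : 4 < n) (hfix : ∀ a, θ a ≠ a) (hinv : ∀ a, θ (θ a) = a)
    (φ : NaturalSimple F n →ₗ[F] NaturalSimple F n)
    (hφ : ∀ a d, φ (naturalSimple F n (Equiv.swap a (θ a)) d) =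
      naturalSimple F n (Equiv.swap a (θ a)) (φ d)) :
    ∃ c : F, ∀ d, (∀ a, pairFunctional a (θ a) d = 0) → φ d = c • d := by
  have hφs : ∀ a, ∃ l : F, φ (natClass F n (pairVec a (θ a))) =
      l • natClass F n (pairVec a (θ a)) := by
    intro a
    -- With δ_a(d) = 1, v_a = t_a d - d; applying φ gives t_a φ(d) - φ(d), a multiple of v_a.
    obtain ⟨d, hd⟩ := exists_pairFunctional_eq_one (F := F) hn hfix a
    refine ⟨pairFunctional a (θ a) (φ d), ?_⟩
    have := hφ a d
    rwa [naturalSimple_swap (hfix a), naturalSimple_swap (hfix a), hd, one_smul, map_add,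
      add_right_inj] at this
  choose l hl using hφs
  have hlθ : ∀ a, l (θ a) = l a := by
    intro a
    have h1 := hl (θ a)
    have h2 : (pairVec (θ a) (θ (θ a)) : zeroSum F n) = pairVec a (θ a) := by
      ext i
      rw [pairVec_apply, pairVec_apply, hinv, add_comm]
    rw [h2, hl a] at h1
    exact (smul_left_injective F (pairClass_ne_zero hn hfix a) h1).symm
  have hone := sum_smul_pairVec (F := F) hfix hinv 1 (fun _ => rfl)
  have hsum : ∑ a with a < θ a, natClass F n (pairVec a (θ a)) = 0 := by
    rw [← map_sum, natClass_eq_zero_iff]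
    refine ⟨1, fun i => ?_⟩
    have := congrFun hone i
    simpa only [Pi.one_apply, one_smul] using this
  -- Applying φ to ∑ v_a = 0 shows that the vector with coordinates l represents 0 in D, so l is
  -- constant.
  have hlsum : natClass F n (∑ a with a < θ a, l a • pairVec a (θ a)) = 0 := by
    rw [map_sum, ← map_zero φ, ← hsum, map_sum]
    exact Finset.sum_congr rfl fun a _ => by rw [map_smul, hl]
  obtain ⟨c, hc⟩ := (natClass_eq_zero_iff _).1 hlsum
  rw [sum_smul_pairVec hfix hinv l hlθ] at hc
  refine ⟨c, fun d hd => ?_⟩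
  obtain ⟨z, rfl⟩ := eq_sum_pairClass hfix hinv hd
  rw [map_sum, Finset.smul_sum]
  exact Finset.sum_congr rfl fun a _ => by rw [map_smul, hl, hc, smul_comm]

/-- The elementary abelian group generated by the transpositions `(a θ(a))`. -/
def pairGroup (θ : Perm (Fin n)) : Subgroup (Perm (Fin n)) :=
  Subgroup.closure (Set.range fun a => Equiv.swap a (θ a))

theorem swap_mem_pairGroup (a : Fin n) : Equiv.swap a (θ a) ∈ pairGroup θ :=
  Subgroup.subset_closure ⟨a, rfl⟩

theorem apply_eq_or_of_mem_pairGroup (hinv : ∀ a, θ (θ a) = a) {e : Perm (Fin n)}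
    (he : e ∈ pairGroup θ) : ∀ i, e i = i ∨ e i = θ i := by
  induction he using Subgroup.closure_induction with
  | mem x hx =>
    obtain ⟨a, rfl⟩ := hx
    intro i
    rcases eq_or_ne i a with rfl | hia
    · simp
    · rcases eq_or_ne i (θ a) with rfl | hib
      · simp [hinv]
      · simp [Equiv.swap_apply_of_ne_of_ne hia hib]
  | one => simp
  | mul x y _ _ hx hy =>
    intro i
    rw [Equiv.Perm.mul_apply]
    rcases hy i with h | h <;> rw [h]
    · exact hx i
    · rcases hx (θ i) with h' | h' <;> rw [h']
      · exact Or.inr rfl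
      · exact Or.inl (hinv i)
  | inv x _ hx =>
    intro i
    obtain ⟨j, rfl⟩ := x.surjective i
    rw [Equiv.Perm.inv_def, Equiv.symm_apply_apply]
    rcases hx j with h | h
    · exact Or.inl h.symm
    · exact Or.inr (by rw [h, hinv])

theorem isPGroup_pairGroup (hfix : ∀ a, θ a ≠ a) (hinv : ∀ a, θ (θ a) = a) :
    IsPGroup 2 (pairGroup θ) := by
  intro e
  refine ⟨1, Subtype.ext (Equiv.ext fun i => ?_)⟩
  have h := apply_eq_or_of_mem_pairGroup hinv e.2
  rw [pow_one, pow_two]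
  change (e : Perm (Fin n)) ((e : Perm (Fin n)) i) = i
  rcases h i with h1 | h1
  · rw [h1, h1]
  · rw [h1]
    rcases h (θ i) with h2 | h2
    · exact absurd (e.1.injective (h1.trans h2.symm)).symm (hfix i)
    · rw [h2, hinv]

theorem conj_mem_pairGroup {p e : Perm (Fin n)} (hp : p * θ = θ * p) (he : e ∈ pairGroup θ) :
    p * e * p⁻¹ ∈ pairGroup θ := by
  induction he using Subgroup.closure_induction with
  | mem x hx =>
    obtain ⟨a, rfl⟩ := hx
    have h : p (θ a) = θ (p a) := Equiv.Perm.congr_fun hp a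
    have := swap_mem_pairGroup (θ := θ) (p a)
    rwa [← h, Equiv.swap_apply_apply] at this
  | one => simp [one_mem]
  | mul x y _ _ hx hy => simpa [mul_assoc] using mul_mem hx hy
  | inv x _ hx => simpa [mul_assoc] using inv_mem hx

/-- P centralizes θ, hence permutes the transpositions t_a and normalizes the pair group. Their join
is a 2-group, so maximality of P absorbs it. -/
theorem pairGroup_le_sylow (hfix : ∀ a, θ a ≠ a) (hinv : ∀ a, θ (θ a) = a)
    (P : Sylow 2 (Perm (Fin n)))
    (hP : ∀ p ∈ (P : Subgroup (Perm (Fin n))), p * θ = θ * p) :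
    pairGroup θ ≤ (P : Subgroup (Perm (Fin n))) := by
  have hnorm : (P : Subgroup (Perm (Fin n))) ≤ Subgroup.normalizer (pairGroup θ) := by
    intro p hp
    rw [Subgroup.mem_normalizer_iff]
    refine fun e => ⟨conj_mem_pairGroup (hP p hp), fun h => ?_⟩
    have := conj_mem_pairGroup (hP p⁻¹ (inv_mem hp)) h
    simpa [mul_assoc] using this
  have := IsPGroup.to_sup_of_normal_right' P.2 (isPGroup_pairGroup hfix hinv) hnorm
  rw [← P.3 this le_sup_left]
  exact le_sup_right

theorem pairFunctional_eq_zero_of_swap (hn : 4 < n) (hfix : ∀ a, θ a ≠ a) {a : Fin n}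
    {d : NaturalSimple F n} (h : naturalSimple F n (Equiv.swap a (θ a)) d = d) :
    pairFunctional a (θ a) d = 0 := by
  rw [naturalSimple_swap (hfix a), add_eq_left] at h
  exact (smul_eq_zero.1 h).resolve_right (pairClass_ne_zero hn hfix a)

/-- The relative trace from a subgroup of index `2` of the pair group vanishes on `D^{(n-1,1)}`. -/
theorem exists_trace_eq_zero (hn : 4 < n) (hfix : ∀ a, θ a ≠ a) (hinv : ∀ a, θ (θ a) = a)
    (K : Subgroup (pairGroup θ)) (hK : K.index = 2) (z : NaturalSimple F n)
    (hz : ∀ k ∈ K, resSubgroup (pairGroup θ) (naturalSimple F n) k z = z) :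
    ∃ e ∉ K, z + resSubgroup (pairGroup θ) (naturalSimple F n) e z = 0 := by
  let t : Fin n → pairGroup θ := fun a => ⟨Equiv.swap a (θ a), swap_mem_pairGroup a⟩
  have ht : ∀ a d, resSubgroup (pairGroup θ) (naturalSimple F n) (t a) d =
      d + pairFunctional a (θ a) d • natClass F n (pairVec a (θ a)) :=
    fun a d => naturalSimple_swap (hfix a) d
  obtain ⟨a, ha⟩ : ∃ a, t a ∉ K := by
    by_contra! h
    have htop : K = ⊤ := by
      have hcl := Subgroup.closure_closure_coe_preimage
        (k := Set.range fun a => Equiv.swap a (θ a))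
      refine eq_top_iff.2 (hcl.ge.trans ((Subgroup.closure_le _).2 ?_))
      rintro ⟨_, he⟩ ⟨a, rfl⟩
      exact h a
    rw [htop, Subgroup.index_top] at hK
    omega
  refine ⟨t a, ha, ?_⟩
  suffices h0 : pairFunctional a (θ a) z = 0 by
    rw [ht, h0, zero_smul, add_zero, ← two_smul F, CharTwo.two_eq_zero, zero_smul]
  -- If t_b for another pair also lies outside K, then t_a t_b is in K and fixes z, giving δ_a(z)
  -- v_a + δ_b(z) v_b = 0. Otherwise δ_b(z) = 0 for all other pairs, and the coordinate sum being 0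
  -- leaves δ_a(z) = 0.
  by_cases hb : ∃ b, b ≠ a ∧ b ≠ θ a ∧ t b ∉ K
  · obtain ⟨b, hba, hba', hbK⟩ := hb
    have hmem : t a * t b ∈ K := by
      rw [Subgroup.mul_mem_iff_of_index_two hK]
      tauto
    have h := hz _ hmem
    rw [map_mul, Module.End.mul_apply, ht b, map_add, map_smul, ht a, ht a,
      pairFunctional_pairClass hinv, zero_smul, add_zero, add_assoc, add_eq_left] at h
    exact (pairClass_independent hn hfix hinv hba hba' h).1
  · push Not at hb
    have hδ : ∀ b, b ≠ a → b ≠ θ a → pairFunctional b (θ b) z = 0 := fun b h1 h2 =>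
      pairFunctional_eq_zero_of_swap hn hfix (hz (t b) (hb b h1 h2))
    have hsum := sum_pairFunctional hfix hinv z
    have hsymm : pairFunctional (θ a) (θ (θ a)) z = pairFunctional a (θ a) z := by
      obtain ⟨x, rfl⟩ := natClass_surjective z
      rw [pairFunctional_natClass, pairFunctional_natClass, hinv, add_comm]
    -- The sum runs over the smaller element of each pair, which may be a or θ(a).
    rcases lt_or_gt_of_ne (hfix a) with hlt | hlt
    · rw [Finset.sum_eq_single (θ a)] at hsum
      · rwa [hsymm] at hsum
      · intro b hbT hbne
        refine hδ b ?_ hbne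
        rintro rfl
        exact hlt.not_gt (Finset.mem_filter.1 hbT).2
      · simp [hinv, hlt]
    · rw [Finset.sum_eq_single a] at hsum
      · exact hsum
      · intro b hbT hbne
        refine hδ b hbne ?_
        rintro rfl
        have := (Finset.mem_filter.1 hbT).2
        rw [hinv] at this
        exact hlt.not_gt this
      · simp [hlt]

end Pairing

/-! ### Indecomposability and restriction. -/

section Indecomposability

variable {F : Type u} [Field F] {G : Type v} [Group G]
variable {V : Type w} [AddCommGroup V] [Module F V]

theorem IsCompl.toSubmodule {ρ : Representation F G V} {A B : Subrepresentation ρ}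
    (h : IsCompl A B) : IsCompl A.toSubmodule B.toSubmodule := by
  refine IsCompl.of_eq ?_ ?_
  · rw [← Subrepresentation.toSubmodule_inf, h.inf_eq_bot]
    rfl
  · rw [← Subrepresentation.toSubmodule_sup, h.sup_eq_top]
    rfl

theorem IsIndecomposable.of_res {ρ : Representation F G V} {H : Subgroup G}
    (h : IsIndecomposable (resSubgroup H ρ)) : IsIndecomposable ρ := by
  refine ⟨h.1, fun A B hAB => ?_⟩
  let A' : Subrepresentation (resSubgroup H ρ) := ⟨A.toSubmodule, fun g => A.2 g⟩
  let B' : Subrepresentation (resSubgroup H ρ) := ⟨B.toSubmodule, fun g => B.2 g⟩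
  have hc := hAB.toSubmodule
  have hAB' : IsCompl A' B' := by
    refine IsCompl.of_eq ?_ ?_ <;> apply Subrepresentation.toSubmodule_injective
    · exact hc.inf_eq_bot
    · exact hc.sup_eq_top
  rcases h.2 A' B' hAB' with h0 | h0
  · exact Or.inl (Subrepresentation.toSubmodule_injective
      (show A'.toSubmodule = ⊥ by rw [h0]; rfl))
  · exact Or.inr (Subrepresentation.toSubmodule_injective
      (show B'.toSubmodule = ⊥ by rw [h0]; rfl))

end Indecomposability

/-! ### Indecomposability of the restriction and minimality of the vertex. -/

section NaturalModule

variable {F : Type u} [Field F] [CharP F 2] {n : ℕ} {θ : Perm (Fin n)}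

/-- A non-zero submodule stable under the transpositions `(a θ(a))` contains a non-zero vector
fixed by all of them. -/
theorem exists_fixed_of_ne_bot (hn : 4 < n) (hfix : ∀ a, θ a ≠ a) (hinv : ∀ a, θ (θ a) = a)
    (A : Submodule F (NaturalSimple F n))
    (hA : ∀ a, ∀ d ∈ A, naturalSimple F n (Equiv.swap a (θ a)) d ∈ A) (hbot : A ≠ ⊥) :
    ∃ d ∈ A, d ≠ 0 ∧ ∀ a, pairFunctional a (θ a) d = 0 := by
  obtain ⟨d, hd, hd0⟩ := A.exists_mem_ne_zero_of_ne_bot hbot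
  by_cases h : ∀ a, pairFunctional a (θ a) d = 0
  · exact ⟨d, hd, hd0, h⟩
  · push Not at h
    obtain ⟨a, ha⟩ := h
    refine ⟨natClass F n (pairVec a (θ a)), ?_, pairClass_ne_zero hn hfix a,
      fun b => pairFunctional_pairClass hinv b a⟩
    -- t_a d - d is a non-zero multiple of v_a, so v_a lies in A.
    have h1 := A.sub_mem (hA a d hd) hd
    rw [naturalSimple_swap (hfix a), add_sub_cancel_left] at h1
    exact (A.smul_mem_iff ha).1 h1

/-- The restriction of `D^{(n-1,1)}` to a subgroup containing the pair group is indecomposable. -/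
theorem isIndecomposable_res (hn : 4 < n) (hfix : ∀ a, θ a ≠ a) (hinv : ∀ a, θ (θ a) = a)
    {H : Subgroup (Perm (Fin n))} (hH : pairGroup θ ≤ H) :
    IsIndecomposable (resSubgroup H (naturalSimple F n)) := by
  refine ⟨⟨natClass F n (pairVec ⟨0, by omega⟩ (θ ⟨0, by omega⟩)), 0,
    pairClass_ne_zero hn hfix _⟩, fun A B hAB => ?_⟩
  have hc := hAB.toSubmodule
  have hA : ∀ a, ∀ d ∈ A.toSubmodule, naturalSimple F n (Equiv.swap a (θ a)) d ∈ A.toSubmodule :=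
    fun a d hd => A.2 ⟨_, hH (swap_mem_pairGroup a)⟩ hd
  have hB : ∀ a, ∀ d ∈ B.toSubmodule, naturalSimple F n (Equiv.swap a (θ a)) d ∈ B.toSubmodule :=
    fun a d hd => B.2 ⟨_, hH (swap_mem_pairGroup a)⟩ hd
  let φ := Submodule.projection _ _ hc
  have hφA : ∀ x ∈ A.toSubmodule, φ x = x := fun x hx => Submodule.projection_apply_left hc ⟨x, hx⟩
  have hφB : ∀ x ∈ B.toSubmodule, φ x = 0 := fun x hx => Submodule.projection_apply_right hc ⟨x, hx⟩
  obtain ⟨c, hcs⟩ := exists_scalar_of_commute hn hfix hinv φ (by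
    intro a d
    obtain ⟨x, hx, y, hy, rfl⟩ := Submodule.mem_sup.1 (hc.sup_eq_top ▸ Submodule.mem_top (x := d))
    rw [map_add, map_add, map_add, hφA x hx, hφB y hy, hφA _ (hA a x hx), hφB _ (hB a y hy),
      add_zero, add_zero])
  by_contra! hne
  obtain ⟨x, hx, hx0, hxf⟩ := exists_fixed_of_ne_bot hn hfix hinv _ hA
    (fun h => hne.1 (Subrepresentation.toSubmodule_injective h))
  obtain ⟨y, hy, hy0, hyf⟩ := exists_fixed_of_ne_bot hn hfix hinv _ hB
    (fun h => hne.2 (Subrepresentation.toSubmodule_injective h))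
  have h1 := hcs x hxf
  have h2 := hcs y hyf
  rw [hφA x hx] at h1
  rw [hφB y hy] at h2
  rw [(smul_eq_zero.1 h2.symm).resolve_right hy0, zero_smul] at h1
  exact hx0 h1

theorem naturalSimple_apply_of_mem_pairGroup (hfix : ∀ a, θ a ≠ a)
    {d : NaturalSimple F n} (hd : ∀ a, pairFunctional a (θ a) d = 0) {e : Perm (Fin n)}
    (he : e ∈ pairGroup θ) : naturalSimple F n e d = d := by
  induction he using Subgroup.closure_induction with
  | mem x hx =>
    obtain ⟨a, rfl⟩ := hx
    rw [naturalSimple_swap (hfix a), hd, zero_smul, add_zero]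
  | one => simp
  | mul x y _ _ hx hy => rw [map_mul, Module.End.mul_apply, hy, hx]
  | inv x _ hx =>
    conv_lhs => rw [← hx]
    simp

open Classical in
/-- If `D^{(n-1,1)}` is relatively projective with respect to a subgroup `Q` of a `2`-group `P`
centralizing a fixed-point-free involution, then `Q = P`. -/
theorem le_of_isRelProjective (hn : 4 < n) (hfix : ∀ a, θ a ≠ a) (hinv : ∀ a, θ (θ a) = a)
    {P Q : Subgroup (Perm (Fin n))} (hP2 : IsPGroup 2 P) (hP : ∀ p ∈ P, p * θ = θ * p)
    (hQP : Q ≤ P) (hQ : IsRelProjective (naturalSimple F n) Q) : P ≤ Q := by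
  by_contra hPQ
  obtain ⟨φ, hφ, htr⟩ := hQ.exists_trace_eq_id
  set ρ := naturalSimple F n with hρ
  let f : Perm (Fin n) ⧸ Q → NaturalSimple F n →ₗ[F] NaturalSimple F n :=
    fun c => conjEnd ρ φ c.out
  have hf : ∀ g c x, f (g • c) (ρ g x) = ρ g (f c x) := conjEnd_smul_out ρ hφ
  -- T is the set of cosets fixed by E. For c in T the map f c commutes with E, hence is a scalar l
  -- c on the common kernel of the δ_a.
  let T : Finset (Perm (Fin n) ⧸ Q) := {c | ∀ e : pairGroup θ, e • c = c}
  have hT : ∀ c, c ∈ T ↔ ∀ e : pairGroup θ, e • c = c := fun c => by simp [T]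
  have hscal : ∀ c, ∃ l : F, c ∈ T → ∀ d, (∀ a, pairFunctional a (θ a) d = 0) →
      f c d = l • d := by
    intro c
    by_cases hc : c ∈ T
    · obtain ⟨l, hl⟩ := exists_scalar_of_commute hn hfix hinv (f c) (fun a d => by
        have h1 := hf (Equiv.swap a (θ a)) c d
        have h2 : Equiv.swap a (θ a) • c = c := (hT c).1 hc ⟨_, swap_mem_pairGroup a⟩
        rwa [h2] at h1)
      exact ⟨l, fun _ => hl⟩
    · exact ⟨0, fun h => absurd h hc⟩
  choose l hl using hscal
  have hTP : ∀ (p : P), ∀ c ∈ T, p • c ∈ T := by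
    intro p c hc
    rw [hT] at hc ⊢
    intro e
    have h1 := hc ⟨(p : Perm (Fin n))⁻¹ * e * ((p : Perm (Fin n))⁻¹)⁻¹,
      conj_mem_pairGroup (hP _ (inv_mem p.2)) e.2⟩
    change ((p : Perm (Fin n))⁻¹ * e * ((p : Perm (Fin n))⁻¹)⁻¹) • c = c at h1
    change (e : Perm (Fin n)) • (p : Perm (Fin n)) • c = (p : Perm (Fin n)) • c
    rw [mul_smul, mul_smul, inv_smul_eq_iff, inv_inv] at h1
    exact h1
  let a₀ : Fin n := ⟨0, by omega⟩
  set x : NaturalSimple F n := natClass F n (pairVec a₀ (θ a₀)) with hx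
  have hx0 : x ≠ 0 := pairClass_ne_zero hn hfix a₀
  have hxf : ∀ a, pairFunctional a (θ a) x = 0 := fun a => pairFunctional_pairClass hinv a a₀
  -- An element p carries v_a to v_{p(a)}, again in the common kernel, so comparing f c at v_a with
  -- f (p • c) at v_{p(a)} identifies the scalars.
  have hlP : ∀ (p : P), ∀ c ∈ T, l (p • c) = l c := by
    intro p c hc
    have h1 := hf p c x
    have hθ : (p : Perm (Fin n)) (θ a₀) = θ ((p : Perm (Fin n)) a₀) :=
      Equiv.Perm.congr_fun (hP _ p.2) a₀
    have hpx : ρ p x = natClass F n (pairVec (p.1 a₀) (θ (p.1 a₀))) := by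
      rw [hx, hρ, naturalSimple_pairVec, hθ]
    rw [hl c hc x hxf, map_smul, hpx] at h1
    have h2 := hl (p • c) (hTP p c hc) _ fun a =>
      pairFunctional_pairClass (F := F) hinv a (p.1 a₀)
    exact smul_left_injective F (pairClass_ne_zero hn hfix _) (h2.symm.trans h1)
  have hsumT : ∑ c ∈ T, l c = 0 := by
    refine sum_eq_zero_of_trace_eq_zero hP2 (Representation.trivial F P F) l ?_ T hTP
      (fun p c hc => hlP p c hc) fun c hc => ?_
    · intro K hK z _
      obtain ⟨e, he⟩ : ∃ e, e ∉ K := by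
        by_contra! h
        rw [(Subgroup.eq_top_iff' K).2 h, Subgroup.index_top] at hK
        omega
      exact ⟨e, he, CharTwo.add_self_eq_zero z⟩
    -- A coset gQ fixed by P would give g⁻¹Pg ≤ Q, impossible for a proper subgroup Q of P by
    -- orders.
    · by_contra! h
      obtain ⟨g, rfl⟩ := QuotientGroup.mk_surjective c
      have hmem : ∀ p : P, g⁻¹ * p * g ∈ Q := by
        intro p
        have h1 := h p
        change ((p * g : Perm (Fin n)) : Perm (Fin n) ⧸ Q) = (g : _ ⧸ Q) at h1
        have h2 := QuotientGroup.eq.1 h1.symm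
        rwa [← mul_assoc] at h2
      have hcard : Nat.card P ≤ Nat.card Q :=
        Nat.card_le_card_of_injective (fun p : P => (⟨g⁻¹ * p * g, hmem p⟩ : Q)) fun p p' hpp => by
          simpa using hpp
      exact hPQ (Subgroup.eq_of_le_of_card_ge hQP hcard).ge
  have hsumU : ∑ c with c ∉ T, f c x = 0 := by
    refine sum_eq_zero_of_trace_eq_zero (isPGroup_pairGroup hfix hinv)
      (resSubgroup (pairGroup θ) ρ) (fun c => f c x)
      (fun K hK z hz => exists_trace_eq_zero hn hfix hinv K hK z hz) _ ?_ ?_ ?_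
    · intro e c hc
      simp only [Finset.mem_filter, Finset.mem_univ, true_and, hT, not_forall] at hc ⊢
      obtain ⟨e', he'⟩ := hc
      refine ⟨e * e' * e⁻¹, fun h => he' ?_⟩
      rw [smul_smul, inv_mul_cancel_right, mul_smul] at h
      exact MulAction.injective e h
    · intro e c _
      have h1 := hf e c x
      rw [naturalSimple_apply_of_mem_pairGroup hfix hxf e.2] at h1
      exact h1
    · intro c hc
      simpa only [Finset.mem_filter, Finset.mem_univ, true_and, hT, not_forall] using hc
  refine hx0 ?_
  rw [← htr x, ← Finset.sum_filter_add_sum_filter_not Finset.univ (· ∈ T)]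
  change ∑ c with c ∈ T, f c x + ∑ c with c ∉ T, f c x = 0
  rw [hsumU, add_zero, Finset.filter_mem_eq_inter, Finset.univ_inter,
    Finset.sum_congr rfl fun c hc => hl c hc x hxf, ← Finset.sum_smul, hsumT, zero_smul]

end NaturalModule

/-- Let `F` be an algebraically closed field of characteristic `2` and let `n ≥ 3` be even, but not
a power of `2`.  Then every Sylow `2`-subgroup `P` of `𝔖ₙ` is a vertex of `D^{(n-1,1)}`, and the
restriction of `D^{(n-1,1)}` to `P` is a source. -/
theorem theorem9p1 {F : Type u} [Field F] [IsAlgClosed F] [CharP F 2] (n : ℕ) (hn : 3 ≤ n)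
    (heven : Even n) (hpow : ¬ ∃ m : ℕ, n = 2 ^ m) (P : Sylow 2 (Perm (Fin n))) :
    IsVertex (naturalSimple F n) (P : Subgroup (Perm (Fin n))) ∧
      IsSource (naturalSimple F n) (P : Subgroup (Perm (Fin n)))
        (resSubgroup (P : Subgroup (Perm (Fin n))) (naturalSimple F n)) := by
  obtain ⟨m, hm⟩ := heven
  have hn4 : 4 < n := by
    -- Excluding n = 4 leaves at least three pairs, as needed for the independence of two pair
    -- classes.
    have : n ≠ 4 := fun h => hpow ⟨2, h⟩
    omega
  obtain ⟨θ, hfix, hinv, hP⟩ := exists_involution_centralized (n := n) (m := m) (by omega) P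
  have hres : IsIndecomposable (resSubgroup (P : Subgroup (Perm (Fin n))) (naturalSimple F n)) :=
    isIndecomposable_res hn4 hfix hinv (pairGroup_le_sylow hfix hinv P hP)
  have : Module.Finite F F[Fin n] := Module.Finite.equiv (ofCoords F n)
  have : Fact (Nat.Prime 2) := ⟨Nat.prime_two⟩
  have hsum : IsSummandOf (naturalSimple F n)
      ((resSubgroup (P : Subgroup (Perm (Fin n))) (naturalSimple F n)).ind
        (P : Subgroup (Perm (Fin n))).subtype) := by
    refine isSummandOf_ind_res _ _ ?_
    rw [Ne, CharP.cast_eq_zero_iff F 2]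
    exact P.not_dvd_index
  have hvertex : IsVertex (naturalSimple F n) (P : Subgroup (Perm (Fin n))) :=
    ⟨hres.of_res, ⟨NaturalSimple F n, inferInstance, inferInstance, _, inferInstance, hsum⟩,
      fun Q hQ hQP => le_of_isRelProjective hn4 hfix hinv P.2 hP hQP hQ⟩
  exact ⟨hvertex, hvertex, inferInstance, hres, hsum⟩
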